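/- **Theorem (Finite no-top-star theorem).** Write $[4]=\{0,1,2,3\}$ with its usual order, and order every power of $[4]$ coordinatewise. Index the four coordinates by $\{1,2,3,4\}$. A *wide quad* is a point of $[4]^4$. For a set $S$ of coordinates, a *value on $S$* is an element $H=(H_i)_{i\in S}$ of $[4]^S$; a wide quad $Q$ *extends* $H$, written $Q\supseteq H$, if $Q_i=H_i$ for all $i\in S$. Two values on the same set of coordinates are *disjoint* if they differ in every coordinate; a wide quad $Q$ is disjoint from a value $H$ on $S$ if $Q_i\ne H_i$ for all $i\in S$. A *seed* is a pair $(j,u)$ consisting of a coordinate $j$ and a value $u\in\{0,1\}$. It is disjoint from a value $H$ on $S$ if $j\notin S$ or $H_j\ne u$, and it is disjoint from a wide quad $Q$ if $Q_j\neq u$. A *residual seed matching* for $H$ consists of a seed disjoint from $H$ and three pairwise disjoint wide quads, each disjoint from $H$ and from the seed; it is *hit* by a set $M\subseteq[4]^4$ if at least one of its three wide quads lies in $M$. Let $M\subseteq[4]^4$. For each 2-element set $J$ of coordinates let $P_J\subseteq[4]^J$, and for each 3-element set $I$ of coordinates let $T_I\subseteq[4]^I$. Let $P_2=\bigsqcup_J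 P_J$ and $T_3=\bigsqcup_I T_I$ be the disjoint unions (elements are remembered with their supports). Let $U=\{1,2,3\}^4$. Suppose that: - (N1) $M$ is an up-set in $[4]^4$. - (N2) $U\setminus M$ does not contain three pairwise disjoint wide quads. - (N3) $M\cap U$ contains no full top-star, that is, for no coordinate $i$ does it contain the set $\{x\in U: x_i=3\}$. - (N4) Every $P_J$ is a down-set in $[4]^J$ that does not contain two disjoint values $a,b$ with $\{a_j,b_j\}\ne\{0,1\}$ for some $j\in J$. Every $T_I$ is a down-set in $[4]^I$ that does not contain three pairwise disjoint values $a,b,c$ such that, for some $j\in I$, the unique element of $[4]\setminus\{a_j,b_j,c_j\}$ is $0$ or $1$. - (N5) For every $H$ in some $P_J$ or some $T_I$, every wide quad $Q\supseteq H$ lies outside $M$, and every residual seed matching for $H$ is hit by $M$. Then $$300\,|T_3|+144\,|P_2|\le 625\,|M|.$$ -/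

import Mathlib

namespace NoTopStar

/-- The alphabet is `{0, 1, 2, 3}`; a wide quad is a point of its fourth power, one value for each
of the four coordinates.  The order on wide quads is the coordinatewise one. -/
abbrev Quad : Type := Fin 4 → Fin 4

/-- A `k`-support: a set of `k` of the four coordinates. -/
abbrev Support (k : ℕ) : Type := {S : Finset (Fin 4) // S.card = k}

/-- A value (a wide pair if `S.card = 2`, a wide triple if `S.card = 3`) on the support `S`,
ordered coordinatewise. -/
abbrev Value (S : Finset (Fin 4)) : Type := S → Fin 4

/-- Two points with the same coordinate set are disjoint when they differ in every coordinate. -/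
def Disj {ι : Type} (x y : ι → Fin 4) : Prop := ∀ i, x i ≠ y i

/-- The restriction of a wide quad to a support. -/
def restrict (S : Finset (Fin 4)) (Q : Quad) : Value S := fun i => Q i

/-- The upper cube `{1, 2, 3}⁴`. -/
def upperCube : Finset Quad := Finset.univ.filter fun x => ∀ i, x i ≠ 0

/-- The full top-star in direction `i`: the points of the upper cube whose `i`-th coordinate
is `3`. -/
def topStar (i : Fin 4) : Finset Quad := upperCube.filter fun x => x i = 3

/-- `C` contains three pairwise disjoint quads. -/
def HasThreeMatching (C : Finset Quad) : Prop :=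
  ∃ Q : Fin 3 → Quad, (∀ t, Q t ∈ C) ∧ Pairwise fun s t => Disj (Q s) (Q t)

/-- The forbidden disjoint pair obstruction: two disjoint values such that, in some
coordinate, the two values used are not exactly `0` and `1`. -/
def PairObstruction {ι : Type} (a b : ι → Fin 4) : Prop :=
  Disj a b ∧ ∃ j, ({a j, b j} : Finset (Fin 4)) ≠ {0, 1}

/-- A bad 3-matching: three pairwise disjoint values such that, in some coordinate, the value not
used by them is `0` or `1`. -/
def BadThreeMatching {ι : Type} (a b c : ι → Fin 4) : Prop :=
  Disj a b ∧ Disj a c ∧ Disj b c ∧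
    ∃ j, ∃ u ∈ ({0, 1} : Finset (Fin 4)), u ∉ ({a j, b j, c j} : Finset (Fin 4))

/-- Closure for `H`: no wide quad extending `H` belongs to `M`. -/
def Closed (M : Finset Quad) {S : Finset (Fin 4)} (H : Value S) : Prop :=
  ∀ Q : Quad, restrict S Q = H → Q ∉ M

/-- The seed with value `u ∈ {0, 1}` in the single coordinate `j` and the three wide quads
`Q 0, Q 1, Q 2` form a residual seed matching for `H`: the seed is disjoint from `H`, and the
three quads are pairwise disjoint and are disjoint from `H` and from the seed. -/
def IsResidualSeedMatching {S : Finset (Fin 4)} (H : Value S) (j u : Fin 4) (Q : Fin 3 → Quad) :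
    Prop :=
  u ∈ ({0, 1} : Finset (Fin 4)) ∧
  (∀ i : S, (i : Fin 4) = j → H i ≠ u) ∧
  (Pairwise fun s t => Disj (Q s) (Q t)) ∧
  (∀ t, Disj (restrict S (Q t)) H) ∧
  (∀ t, Q t j ≠ u)

/-- Every residual seed matching for `H` is hit by `M`: one of its three wide quads is in `M`. -/
def SeedHitting (M : Finset Quad) {S : Finset (Fin 4)} (H : Value S) : Prop :=
  ∀ (j u : Fin 4) (Q : Fin 3 → Quad), IsResidualSeedMatching H j u Q → ∃ t, Q t ∈ M

/-- The disjoint union over all `k`-supports of a family of sets of values, each value being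
remembered with its support. -/
def total {k : ℕ} (F : (S : Support k) → Finset (Value S.1)) :
    Finset ((S : Support k) × Value S.1) :=
  Finset.univ.sigma F

end NoTopStar

/-!
The points that must lie in `M` are governed by one notion.  A quad `e` is *hit* (`Hits M e`) when
every three pairwise disjoint quads disjoint from `e` include a member of `M`.  If `H` is a value
on `S` with `SeedHitting M H`, then every quad `e` that restricts to `H` and has an entry `0` or
`1` outside `S` is hit (`SeedHitting.hits`): that entry serves as the seed.  Likewise `0000` is
hit because `upperCube \ M` has no three-matching.  Closure puts extensions of `H` outside `M`,
and the top-star hypothesis puts the four corners `3111`, `1311`, `1131`, `1113` outside `M`.  So a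
single large value in `P` or `T` makes the up-set `M` large.

*Lower bounds for* `|M|`.  Given a list of hit quads and a list of quads outside `M`, a lower
bound for `|M|` follows from a case distinction over whether chosen quads belong to `M`: the known
part of `M` is closed upwards, the known part of the complement downwards, and whenever two quads
of a three-matching around a hit quad are known to be outside `M`, the third is in `M`.  This is
the function `check`, a computation with sets of quads stored as 256-bit numbers; `le_card_of_check`
is its soundness, valid after any permutation of the coordinates.  It gives `27 ≤ |M|`, the bounds
`check_triple_…` of the shape "if `y` lies in some `T I`, then `B ≤ |M|`", and `67 ≤ |M|` as soon
as `P J` is nonempty for two different supports `J`.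

*Upper bounds for the families.*  A set `P J` has at most `4` elements.  For a set of triples
without a bad three-matching, a family of blocks in which any three points form a bad three-matching
bounds the size: each block contributes at most two points (`NoBad.card_le`).
Together with the triples excluded by the lower bounds for `|M|`, this gives
`1200 |T I| + 576 ≤ 625 |M|` for every `I` (`Seeded.card_le`), and `|T I| ≤ 32` in any case.

*Conclusion.*  If `|M| ≤ 66`, at most one `P J` is nonempty, hence `144 |P₂| ≤ 576`, and summing
the bound for the four supports `I` gives the claim.  If `|M| ≥ 67`, then
`300 · 4 · 32 + 144 · 6 · 4 = 41856 ≤ 625 · 67`.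
-/

namespace NoTopStar

/-! ### Sets of quads as 256-bit numbers, and the case distinction as a computation -/

/-- The base-four digit that stands for the value `a`.  Values are rotated by two because large
literals are hashed by their low 64 bits in the kernel: these bits then describe the quads with
last entry `2`, which differ between the sets met in the computation. -/
def digit (a : ℕ) : ℕ := (a + 2) % 4

/-- The bit index of a quad: the number with base-four digits `digit (Q i)`. -/
def code (Q : Quad) : ℕ := digit (Q 0) + 4 * digit (Q 1) + 16 * digit (Q 2) + 64 * digit (Q 3)

/-- `f n`, written with the recursor on `n` so that `n` is evaluated to a literal before it is
substituted into `f`. -/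
noncomputable def force {α : Type} (n : ℕ) (f : ℕ → α) : α :=
  Nat.rec (f 0) (fun k _ => f (Nat.succ k)) n

/-- `a` if `n = 0`, and `b` otherwise, written with the recursor so that it reduces quickly. -/
noncomputable def ifZero {α : Type} (n : ℕ) (a b : α) : α := Nat.rec a (fun _ _ => b) n

/-- The set of quads with `i`-th entry `a`. -/
def layer (i a : ℕ) : ℕ :=
  Nat.shiftLeft ((2 ^ 4 ^ i - 1) * ((2 ^ 256 - 1) / (2 ^ 4 ^ (i + 1) - 1))) (digit a * 4 ^ i)

/-- The quads obtained from the members of `x` with `i`-th entry `a` by changing that entry to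
`b`. -/
def move (i a b x : ℕ) : ℕ :=
  Nat.shiftRight (Nat.shiftLeft (Nat.land x (layer i a)) (digit b * 4 ^ i)) (digit a * 4 ^ i)

/-- Adds to `x` its members with `i`-th entry `a`, that entry raised to `a + 1`. -/
def raise (i a x : ℕ) : ℕ := Nat.lor x (move i a (a + 1) x)

/-- Adds to `x` its members with `i`-th entry `a + 1`, that entry lowered to `a`. -/
def lower (i a x : ℕ) : ℕ := Nat.lor x (move i (a + 1) a x)

/-- The up-set generated by `x`. -/
noncomputable def upClosure (x : ℕ) : ℕ :=
  [0, 1, 2, 3].foldr (fun i f x =>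
    force x fun x => force (raise i 0 x) fun y => force (raise i 1 y) fun z =>
      force (raise i 2 z) f) id x

/-- The down-set generated by `x`. -/
noncomputable def downClosure (x : ℕ) : ℕ :=
  [0, 1, 2, 3].foldr (fun i f x =>
    force x fun x => force (lower i 2 x) fun y => force (lower i 1 y) fun z =>
      force (lower i 0 z) f) id x

/-- The three values other than `e`. -/
def others (e : Fin 4) : ℕ × ℕ × ℕ := ![(1, 2, 3), (0, 2, 3), (0, 1, 3), (0, 1, 2)] e

/-- The image of `x` under the cyclic change `a → b → c → a` of the `i`-th entry; members of
`x` with another `i`-th entry are dropped. -/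
def cycle (i a b c x : ℕ) : ℕ := Nat.lor (move i a b x) (Nat.lor (move i b c x) (move i c a x))

/-- The image of `x` under the cyclic change of the `i`-th entry through the three values other
than `e`; members of `x` with `i`-th entry `e` are dropped. -/
noncomputable def rot (i e : Fin 4) (x : ℕ) : ℕ :=
  cycle i (others e).1 (others e).2.1 (others e).2.2 x

/-- The image of `x` under the inverse of the cyclic change of `rot`. -/
noncomputable def tor (i e : Fin 4) (x : ℕ) : ℕ :=
  cycle i (others e).1 (others e).2.2 (others e).2.1 x

/-- The quads `Q` for which there are `R ∈ A` and `S ∈ B` that agree with `Q` outside `L` and such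
that `R i`, `S i`, `Q i` are the three values other than `e i` for each `i ∈ L`.  In each
coordinate the order of the three values is one of the two cyclic ones, whence the two branches. -/
noncomputable def third (e : Quad) (L : List (Fin 4)) : ℕ → ℕ → ℕ :=
  List.rec (motive := fun _ => ℕ → ℕ → ℕ) (fun A B => Nat.land A B)
    (fun i _ ih A B =>
      force (force (rot i (e i) A) fun A' => force (tor i (e i) B) fun B' => ih A' B') fun x =>
      force (force (tor i (e i) A) fun A' => force (rot i (e i) B) fun B' => ih A' B') fun y =>
      Nat.lor x y) L

/-- The quads that complete two members of `D` to three pairwise disjoint quads, all disjoint from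
one and the same `e ∈ E`.  Exchanging the two members of `D` reverses the cyclic order in every
coordinate, so one order suffices in coordinate `0`. -/
noncomputable def forced (E : List Quad) (D : ℕ) : ℕ :=
  List.rec (motive := fun _ => ℕ) 0 (fun e _ ih =>
    force (force (rot 0 (e 0) D) fun A =>
      force (tor 0 (e 0) D) fun B => third e [1, 2, 3] A B) fun x => force ih fun y =>
    Nat.lor x y) E

/-- The number with `n` base-256 digits, all equal to `1`. -/
def byteMask (n : ℕ) : ℕ := (256 ^ n - 1) / 255

/-- The number of quads in `x`, modulo `255`.  The eight summands count bits within each byte, and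
reduction modulo `255` adds the bytes up. -/
noncomputable def popCount (x : ℕ) : ℕ :=
  Nat.mod ([0, 1, 2, 3, 4, 5, 6, 7].foldr
    (fun r n => Nat.add n (Nat.land (Nat.shiftRight x r) (byteMask 32))) 0) 255

/-- Whether a case is settled: the known members `M` and the known non-members `D` overlap, or `M`
has at least `B` elements, or `rest` holds.  The mask discards bits that stand for no quad. -/
noncomputable def closes (B D M : ℕ) (rest : Bool) : Bool :=
  ifZero (Nat.land (Nat.land D M) (2 ^ 256 - 1))
    (bif Nat.ble B (popCount M) then true else rest) true

/-- The case distinction: for each index in `L` whose quad is not yet known to be in or outside the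
set, both cases are considered.  `D` holds the known non-members and `M` the known members.  New
members are forced only by new non-members, so `forced` is not needed in the first case. -/
noncomputable def search (E : List Quad) (B : ℕ) (L : List ℕ) : ℕ → ℕ → Bool :=
  List.rec (motive := fun _ => ℕ → ℕ → Bool) (fun _ _ => false)
  (fun p _ ih D M =>
    ifZero (Nat.land (Nat.shiftLeft 1 p) (Nat.lor D M))
      ((force (upClosure (Nat.lor M (Nat.shiftLeft 1 p))) fun M' => closes B D M' (ih D M')) &&
       (force (downClosure (Nat.lor D (Nat.shiftLeft 1 p))) fun D' =>
        force (upClosure (Nat.lor M (forced E D'))) fun M' => closes B D' M' (ih D' M')))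
      (ih D M)) L

/-- Whether the case distinction along `L` shows that an up-set in which all quads of `E` are hit
and which contains no quad of `F` has at least `B` elements.  Soundness does not depend on `L`, a
list of bit indices chosen to keep the number of cases small. -/
noncomputable def check (E F : List Quad) (B : ℕ) (L : List ℕ) : Bool :=
  force (downClosure (F.foldr (fun d x => Nat.lor x (Nat.shiftLeft 1 (code d))) 0)) fun D =>
  force (upClosure (forced E D)) fun M => closes B D M (search E B L D M)

/-! ### Soundness of the case distinction -/

theorem force_eq {α : Type} (n : ℕ) (f : ℕ → α) : force n f = f n := by cases n <;> rfl

theorem ifZero_eq {α : Type} (n : ℕ) (a b : α) : ifZero n a b = if n = 0 then a else b := by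
  cases n <;> rfl

/-- The quad `Q` belongs to the set stored in the number `x`. -/
def Mem (x : ℕ) (Q : Quad) : Prop := x.testBit (code Q) = true

/-- The quad with bit index `n`, an inverse of `code`. -/
def decode (n : ℕ) : Quad := fun i => Fin.ofNat 4 (n / 4 ^ (i : ℕ) + 2)

theorem code_lt (Q : Quad) : code Q < 256 := by
  unfold code digit; omega

theorem code_decode {n : ℕ} (hn : n < 256) : code (decode n) = n := by
  simp [code, digit, decode, Fin.ofNat]; omega

theorem decode_code (Q : Quad) : decode (code Q) = Q := by
  funext i
  fin_cases i <;> simp [code, digit, decode, Fin.ofNat, Fin.ext_iff] <;> omega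

theorem code_injective : Function.Injective code :=
  Function.LeftInverse.injective decode_code

theorem not_mem_zero (Q : Quad) : ¬ Mem 0 Q := by simp [Mem]

theorem mem_lor {x y : ℕ} {Q : Quad} : Mem (Nat.lor x y) Q ↔ Mem x Q ∨ Mem y Q := by
  simp [Mem]

theorem mem_land {x y : ℕ} {Q : Quad} : Mem (Nat.land x y) Q ↔ Mem x Q ∧ Mem y Q := by
  simp [Mem]

theorem mem_shiftLeft_one {p : ℕ} {Q : Quad} : Mem (Nat.shiftLeft 1 p) Q ↔ code Q = p := by
  have : Nat.shiftLeft 1 p = 1 <<< p := rfl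
  rw [Mem, this, Nat.one_shiftLeft, Nat.testBit_two_pow, decide_eq_true_eq, eq_comm]

/-- The bound covers the bits met in `mem_move`: `255 + 3 * 64 < 450`. -/
theorem digit_of_testBit_layer : ∀ i a : Fin 4, ∀ n < 450,
    (layer (i : ℕ) (a : ℕ)).testBit n = true → n / 4 ^ (i : ℕ) % 4 = digit a := by
  decide +kernel

theorem mem_move {i a b : Fin 4} {x : ℕ} {Q : Quad} (h : Mem (move i a b x) Q) :
    Q i = b ∧ Mem x (Function.update Q i a) := by
  have e : move i a b x = ((x &&& layer (i : ℕ) (a : ℕ)) <<< (digit b * 4 ^ (i : ℕ)))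
      >>> (digit a * 4 ^ (i : ℕ)) :=
    rfl
  have hQ := code_lt Q
  simp only [Mem, e, Nat.testBit_shiftRight, Nat.testBit_shiftLeft, Bool.and_eq_true,
    decide_eq_true_eq, Nat.testBit_land, ge_iff_le] at h ⊢
  obtain ⟨h1, h2, h3⟩ := h
  have key : Q i = b ∧ code (Function.update Q i a)
      = digit a * 4 ^ (i : ℕ) + code Q - digit b * 4 ^ (i : ℕ) := by
    have h4 := digit_of_testBit_layer i a _ (by
      unfold digit; fin_cases i <;> simp <;> omega) h3
    clear h2 h3 e
    fin_cases i <;> simp [code, digit, Function.update, Fin.ext_iff] at h1 h4 ⊢ <;> omega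
  exact ⟨key.1, key.2 ▸ h2⟩

/-- Every quad stored in `x` belongs to `M`. -/
def InSet (M : Finset Quad) (x : ℕ) : Prop := ∀ Q, Mem x Q → Q ∈ M

/-- No quad stored in `x` belongs to `M`. -/
def OffSet (M : Finset Quad) (x : ℕ) : Prop := ∀ Q, Mem x Q → Q ∉ M

theorem InSet.lor {M : Finset Quad} {x y : ℕ} (hx : InSet M x) (hy : InSet M y) :
    InSet M (Nat.lor x y) := fun Q h => (mem_lor.1 h).elim (hx Q) (hy Q)

theorem OffSet.lor {M : Finset Quad} {x y : ℕ} (hx : OffSet M x) (hy : OffSet M y) :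
    OffSet M (Nat.lor x y) := fun Q h => (mem_lor.1 h).elim (hx Q) (hy Q)

theorem InSet.move {M : Finset Quad} {i a b : Fin 4} {x : ℕ} (hM : IsUpperSet (M : Set Quad))
    (hab : a ≤ b) (hx : InSet M x) : InSet M (move i a b x) := fun Q h => by
  obtain ⟨h1, h2⟩ := mem_move h
  refine hM ?_ (hx _ h2)
  exact update_le_self_iff.2 (h1 ▸ hab)

theorem OffSet.move {M : Finset Quad} {i a b : Fin 4} {x : ℕ} (hM : IsUpperSet (M : Set Quad))
    (hab : b ≤ a) (hx : OffSet M x) : OffSet M (move i a b x) := fun Q h hQ => by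
  obtain ⟨h1, h2⟩ := mem_move h
  refine hx _ h2 (hM ?_ hQ)
  exact le_update_self_iff.2 (h1 ▸ hab)

theorem InSet.upClosure {M : Finset Quad} {x : ℕ} (hM : IsUpperSet (M : Set Quad))
    (hx : InSet M x) : InSet M (upClosure x) := by
  have step : ∀ (i a : Fin 4) (y : ℕ), a < 3 → InSet M y → InSet M (raise i a y) := by
    intro i a y ha hy
    have := hy.move (i := i) (a := a) (b := a + 1) hM (by revert ha; clear hy; revert a; decide)
    refine hy.lor ?_
    have e : ((a + 1 : Fin 4) : ℕ) = a + 1 := by clear this; revert ha; revert a; decide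
    rwa [e] at this
  have all : ∀ (i : Fin 4) (y : ℕ), InSet M y →
      InSet M (raise i 2 (raise i 1 (raise i 0 y))) := fun i y hy =>
    step i 2 _ (by decide) (step i 1 _ (by decide) (step i 0 _ (by decide) hy))
  simp only [NoTopStar.upClosure, List.foldr, force_eq, id]
  exact all 3 _ (all 2 _ (all 1 _ (all 0 _ hx)))

theorem OffSet.downClosure {M : Finset Quad} {x : ℕ} (hM : IsUpperSet (M : Set Quad))
    (hx : OffSet M x) : OffSet M (downClosure x) := by
  have step : ∀ (i a : Fin 4) (y : ℕ), a < 3 → OffSet M y → OffSet M (lower i a y) := by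
    intro i a y ha hy
    have := hy.move (i := i) (a := a + 1) (b := a) hM (by revert ha; clear hy; revert a; decide)
    refine hy.lor ?_
    have e : ((a + 1 : Fin 4) : ℕ) = a + 1 := by clear this; revert ha; revert a; decide
    rwa [e] at this
  have all : ∀ (i : Fin 4) (y : ℕ), OffSet M y →
      OffSet M (lower i 0 (lower i 1 (lower i 2 y))) := fun i y hy =>
    step i 0 _ (by decide) (step i 1 _ (by decide) (step i 2 _ (by decide) hy))
  simp only [NoTopStar.downClosure, List.foldr, force_eq, id]
  exact all 3 _ (all 2 _ (all 1 _ (all 0 _ hx)))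

/-- `v`, `w` and `z` are the three values other than `e`. -/
def IsTriple (e v w z : Fin 4) : Prop := v ≠ e ∧ w ≠ e ∧ z ≠ e ∧ v ≠ w ∧ v ≠ z ∧ w ≠ z

instance (e v w z : Fin 4) : Decidable (IsTriple e v w z) := by unfold IsTriple; infer_instance

/-- The predecessor of `w` in the cyclic order of the three values other than `e`. -/
def predIn (e w : Fin 4) : Fin 4 :=
  if (w : ℕ) = (others e).1 then Fin.ofNat 4 (others e).2.2
  else if (w : ℕ) = (others e).2.1 then Fin.ofNat 4 (others e).1 else Fin.ofNat 4 (others e).2.1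

/-- The successor of `w` in the cyclic order of the three values other than `e`. -/
def succIn (e w : Fin 4) : Fin 4 :=
  if (w : ℕ) = (others e).1 then Fin.ofNat 4 (others e).2.1
  else if (w : ℕ) = (others e).2.1 then Fin.ofNat 4 (others e).2.2 else Fin.ofNat 4 (others e).1

theorem mem_cycle {i a b c : Fin 4} {x : ℕ} {Q : Quad} (h : Mem (cycle i a b c x) Q) :
    ∃ v, ((v = a ∧ Q i = b) ∨ (v = b ∧ Q i = c) ∨ (v = c ∧ Q i = a)) ∧
      Mem x (Function.update Q i v) := by
  rcases mem_lor.1 h with h | h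
  · obtain ⟨h1, h2⟩ := mem_move h
    exact ⟨a, by simp [h1], h2⟩
  rcases mem_lor.1 h with h | h
  · obtain ⟨h1, h2⟩ := mem_move h
    exact ⟨b, by simp [h1], h2⟩
  · obtain ⟨h1, h2⟩ := mem_move h
    exact ⟨c, by simp [h1], h2⟩

theorem mem_rot {i e : Fin 4} {x : ℕ} {Q : Quad} (h : Mem (rot i e x) Q) :
    Q i ≠ e ∧ Mem x (Function.update Q i (predIn e (Q i))) := by
  have key : ∀ a b c : Fin 4, others e = ((a : ℕ), (b : ℕ), (c : ℕ)) →
      Q i ≠ e ∧ Mem x (Function.update Q i (predIn e (Q i))) := by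
    intro a b c habc
    rw [rot, habc] at h
    obtain ⟨v, hv, hm⟩ := mem_cycle h
    have : ∀ e a b c v q : Fin 4,
      (others e).1 = a ∧ (others e).2.1 = b ∧ (others e).2.2 = c →
      ((v = a ∧ q = b) ∨ (v = b ∧ q = c) ∨ (v = c ∧ q = a)) → q ≠ e ∧ v = predIn e q := by
      decide +kernel
    obtain ⟨h1, h2⟩ := this e a b c v _ (by simp [habc]) hv
    exact ⟨h1, h2 ▸ hm⟩
  revert key
  fin_cases e
  exacts [fun k => k 1 2 3 rfl, fun k => k 0 2 3 rfl, fun k => k 0 1 3 rfl, fun k => k 0 1 2 rfl]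

theorem mem_tor {i e : Fin 4} {x : ℕ} {Q : Quad} (h : Mem (tor i e x) Q) :
    Q i ≠ e ∧ Mem x (Function.update Q i (succIn e (Q i))) := by
  have key : ∀ a b c : Fin 4, others e = ((a : ℕ), (b : ℕ), (c : ℕ)) →
      Q i ≠ e ∧ Mem x (Function.update Q i (succIn e (Q i))) := by
    intro a b c habc
    rw [tor, habc] at h
    obtain ⟨v, hv, hm⟩ := mem_cycle h
    have : ∀ e a b c v q : Fin 4,
      (others e).1 = a ∧ (others e).2.1 = b ∧ (others e).2.2 = c →
      ((v = a ∧ q = c) ∨ (v = c ∧ q = b) ∨ (v = b ∧ q = a)) → q ≠ e ∧ v = succIn e q := by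
      decide +kernel
    obtain ⟨h1, h2⟩ := this e a b c v _ (by simp [habc]) hv
    exact ⟨h1, h2 ▸ hm⟩
  revert key
  fin_cases e
  exacts [fun k => k 1 2 3 rfl, fun k => k 0 2 3 rfl, fun k => k 0 1 3 rfl, fun k => k 0 1 2 rfl]

theorem isTriple_predIn_succIn : ∀ e w : Fin 4, w ≠ e → IsTriple e (predIn e w) (succIn e w) w := by
  decide +kernel

theorem isTriple_succIn_predIn : ∀ e w : Fin 4, w ≠ e → IsTriple e (succIn e w) (predIn e w) w := by
  decide +kernel

theorem exists_of_mem_third {e : Quad} {L : List (Fin 4)} (hL : L.Nodup) {A B : ℕ} {Q : Quad}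
    (h : Mem (third e L A B) Q) : ∃ R S : Quad, Mem A R ∧ Mem B S ∧
      (∀ i ∉ L, R i = Q i ∧ S i = Q i) ∧ ∀ i ∈ L, IsTriple (e i) (R i) (S i) (Q i) := by
  induction L generalizing A B with
  | nil => exact ⟨Q, Q, (mem_land.1 h).1, (mem_land.1 h).2, by simp, by simp⟩
  | cons i L ih =>
    rw [List.nodup_cons] at hL
    have ht : third e (i :: L) A B = Nat.lor
        (third e L (rot i (e i) A) (tor i (e i) B))
        (third e L (tor i (e i) A) (rot i (e i) B)) := by
      simp only [third, force_eq]
    have key : ∀ R S : Quad, ∀ v w, Mem A (Function.update R i v) → Mem B (Function.update S i w) →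
        IsTriple (e i) v w (Q i) →
        (∀ j ∉ L, R j = Q j ∧ S j = Q j) → (∀ j ∈ L, IsTriple (e j) (R j) (S j) (Q j)) →
        ∃ R S : Quad, Mem A R ∧ Mem B S ∧
          (∀ j ∉ i :: L, R j = Q j ∧ S j = Q j) ∧
          ∀ j ∈ i :: L, IsTriple (e j) (R j) (S j) (Q j) := by
      intro R S v w hR hS hi h1 h2
      refine ⟨_, _, hR, hS, fun j hj => ?_, fun j hj => ?_⟩
      · rw [List.mem_cons, not_or] at hj
        simpa [Function.update_of_ne hj.1] using h1 j hj.2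
      · rcases eq_or_ne j i with rfl | hji
        · simpa using hi
        · simpa [Function.update_of_ne hji] using h2 j ((List.mem_cons.1 hj).resolve_left hji)
    rw [ht] at h
    rcases mem_lor.1 h with h | h <;> obtain ⟨R, S, hR, hS, h1, h2⟩ := ih hL.2 h
    · obtain ⟨hR0, hR⟩ := mem_rot hR
      obtain ⟨hS0, hS⟩ := mem_tor hS
      rw [(h1 i hL.1).1] at hR hR0
      rw [(h1 i hL.1).2] at hS
      exact key R S _ _ hR hS (isTriple_predIn_succIn _ _ hR0) h1 h2
    · obtain ⟨hR0, hR⟩ := mem_tor hR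
      obtain ⟨hS0, hS⟩ := mem_rot hS
      rw [(h1 i hL.1).1] at hR hR0
      rw [(h1 i hL.1).2] at hS
      exact key R S _ _ hR hS (isTriple_succIn_predIn _ _ hR0) h1 h2

/-- Every three pairwise disjoint quads that are disjoint from `e` include a member of `M`. -/
def Hits (M : Finset Quad) (e : Quad) : Prop :=
  ∀ Q : Fin 3 → Quad, (Pairwise fun s t => Disj (Q s) (Q t)) → (∀ t, Disj (Q t) e) → ∃ t, Q t ∈ M

theorem OffSet.forced {M : Finset Quad} {E : List Quad} (hE : ∀ e ∈ E, Hits M e) {D : ℕ}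
    (hD : OffSet M D) : InSet M (forced E D) := by
  induction E with
  | nil => exact fun Q h => absurd h (not_mem_zero Q)
  | cons e E ih =>
    rw [List.forall_mem_cons] at hE
    have hf : NoTopStar.forced (e :: E) D = Nat.lor
        (third e [1, 2, 3] (rot 0 (e 0) D) (tor 0 (e 0) D)) (NoTopStar.forced E D) := by
      simp only [NoTopStar.forced, force_eq]
    rw [hf]
    refine InSet.lor (fun Q h => ?_) (ih hE.2)
    obtain ⟨R, S, hR, hS, h1, h2⟩ := exists_of_mem_third (by decide) h
    obtain ⟨hR0, hR⟩ := mem_rot hR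
    obtain ⟨-, hS⟩ := mem_tor hS
    rw [(h1 0 (by decide)).1] at hR hR0
    rw [(h1 0 (by decide)).2] at hS
    have all : ∀ i, IsTriple (e i) (Function.update R 0 (predIn (e 0) (Q 0)) i)
        (Function.update S 0 (succIn (e 0) (Q 0)) i) (Q i) := by
      intro i
      rcases eq_or_ne i 0 with rfl | hi
      · simpa using isTriple_predIn_succIn _ _ hR0
      · simpa [Function.update_of_ne hi] using h2 i (by revert hi; revert i; decide)
    obtain ⟨t, ht⟩ := hE.1 ![_, _, Q]
      (by
        intro s t hst i
        obtain ⟨h1, h2, h3, h4, h5, h6⟩ := all i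
        fin_cases s <;> fin_cases t <;> first | exact absurd rfl hst | skip
        exacts [h4, h5, h4.symm, h6, h5.symm, h6.symm])
      (by
        intro t i
        obtain ⟨h1, h2, h3, h4, h5, h6⟩ := all i
        fin_cases t
        exacts [h1, h2, h3])
    fin_cases t
    exacts [absurd ht (hD _ hR), absurd ht (hD _ hS), ht]

/-- Since `256 ≡ 1` modulo `255`, reducing modulo `255` sums base-256 digits. -/
theorem land_byteMask_mod_le (n x : ℕ) :
    (x &&& byteMask n) % 255 ≤ ∑ k ∈ Finset.range n, (x.testBit (8 * k)).toNat := by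
  induction n generalizing x with
  | zero => simp [byteMask]
  | succ n ih =>
    have hb : byteMask (n + 1) = 256 * byteMask n + 1 := by
      have h : 255 ∣ 256 ^ n - 1 := by simpa using Nat.sub_dvd_pow_sub_pow 256 1 n
      have : 0 < 256 ^ n := by positivity
      rw [byteMask, byteMask]; omega
    have h1 : (x &&& byteMask (n + 1)) / 2 ^ 8 = x / 2 ^ 8 &&& byteMask n := by
      rw [Nat.and_div_two_pow, hb]; congr 1; omega
    have h2 : (x &&& byteMask (n + 1)) % 2 ^ 8 = (x.testBit 0).toNat := by
      rw [Nat.and_mod_two_pow, hb, show (256 * byteMask n + 1) % 2 ^ 8 = 1 by omega,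
        Nat.and_one_is_mod, Nat.testBit_zero]
      rcases Nat.mod_two_eq_zero_or_one x with h | h <;> simp [h]
    have h3 := ih (x / 2 ^ 8)
    have h4 : ∑ k ∈ Finset.range (n + 1), (x.testBit (8 * k)).toNat
        = ∑ k ∈ Finset.range n, ((x / 2 ^ 8).testBit (8 * k)).toNat + (x.testBit 0).toNat := by
      rw [Finset.sum_range_succ']
      congr 1
      refine Finset.sum_congr rfl fun k _ => ?_
      rw [Nat.testBit_div_two_pow]
      ring_nf
    rw [h4]
    omega

theorem sum_range_eight_mul (f : ℕ → ℕ) (n : ℕ) : ∑ m ∈ Finset.range (8 * n), f m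
    = ∑ r ∈ Finset.range 8, ∑ k ∈ Finset.range n, f (r + 8 * k) := by
  induction n with
  | zero => simp
  | succ n ih =>
    simp only [Nat.mul_succ, Finset.sum_range_succ] at ih ⊢
    rw [ih]
    simp only [Finset.range_zero, Finset.sum_empty]
    ring_nf

theorem popCount_le_sum (x : ℕ) :
    popCount x ≤ ∑ m ∈ Finset.range 256, (x.testBit m).toNat := by
  have h := fun r => land_byteMask_mod_le 32 (x >>> r)
  simp only [Nat.testBit_shiftRight] at h
  rw [show 256 = 8 * 32 from rfl, sum_range_eight_mul]
  simp only [Finset.sum_range_succ _ 7, Finset.sum_range_succ _ 6, Finset.sum_range_succ _ 5,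
    Finset.sum_range_succ _ 4, Finset.sum_range_succ _ 3, Finset.sum_range_succ _ 2,
    Finset.sum_range_succ _ 1, Finset.sum_range_one]
  have e : popCount x = ((((((((0 + (x >>> 7 &&& byteMask 32)) + (x >>> 6 &&& byteMask 32))
      + (x >>> 5 &&& byteMask 32)) + (x >>> 4 &&& byteMask 32)) + (x >>> 3 &&& byteMask 32))
      + (x >>> 2 &&& byteMask 32)) + (x >>> 1 &&& byteMask 32))
      + (x >>> 0 &&& byteMask 32)) % 255 := rfl
  have h0 := h 0; have h1 := h 1; have h2 := h 2; have h3 := h 3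
  have h4 := h 4; have h5 := h 5; have h6 := h 6; have h7 := h 7
  rw [e]
  generalize byteMask 32 = y at *
  omega

theorem InSet.popCount_le_card {M : Finset Quad} {x : ℕ} (hx : InSet M x) :
    popCount x ≤ M.card := by
  refine (popCount_le_sum x).trans ?_
  calc ∑ m ∈ Finset.range 256, (x.testBit m).toNat
      = ((Finset.range 256).filter fun m => x.testBit m = true).card := by
        rw [Finset.card_filter]
        exact Finset.sum_congr rfl fun m _ => by cases x.testBit m <;> rfl
    _ ≤ (M.image code).card := by
        refine Finset.card_le_card fun m hm => ?_
        rw [Finset.mem_filter, Finset.mem_range] at hm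
        refine Finset.mem_image.2 ⟨decode m, hx _ ?_, code_decode hm.1⟩
        rw [Mem, code_decode hm.1]
        exact hm.2
    _ ≤ M.card := Finset.card_image_le

theorem le_card_of_closes {M : Finset Quad} {B x y : ℕ} {b : Bool} (hx : OffSet M x)
    (hy : InSet M y) (hb : b = true → B ≤ M.card) (h : closes B x y b = true) : B ≤ M.card := by
  rw [closes, ifZero_eq] at h
  split_ifs at h with h0
  · rcases hB : Nat.ble B (popCount y) with _ | _
    · rw [hB] at h
      exact hb h
    · exact (Nat.le_of_ble_eq_true hB).trans hy.popCount_le_card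
  · obtain ⟨n, hn⟩ := Nat.exists_testBit_of_ne_zero h0
    have e : Nat.land (Nat.land x y) (2 ^ 256 - 1) = (x &&& y) &&& (2 ^ 256 - 1) := rfl
    rw [e, Nat.testBit_land, Nat.testBit_land, Nat.testBit_two_pow_sub_one] at hn
    simp only [Bool.and_eq_true, decide_eq_true_eq] at hn
    have hc := code_decode hn.2
    exact absurd (hy (decode n) (by rw [Mem, hc]; exact hn.1.2))
      (hx (decode n) (by rw [Mem, hc]; exact hn.1.1))

theorem search_cons (E : List Quad) (B p : ℕ) (L : List ℕ) (x y : ℕ) :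
    search E B (p :: L) x y =
      let u := Nat.shiftLeft 1 p
      let y₁ := upClosure (Nat.lor y u)
      let x₂ := downClosure (Nat.lor x u)
      let y₂ := upClosure (Nat.lor y (forced E x₂))
      if Nat.land u (Nat.lor x y) = 0 then
        closes B x y₁ (search E B L x y₁) && closes B x₂ y₂ (search E B L x₂ y₂)
      else search E B L x y := by
  simp only [search, force_eq, ifZero_eq]

theorem le_card_of_search {M : Finset Quad} (hM : IsUpperSet (M : Set Quad)) {E : List Quad}
    (hE : ∀ e ∈ E, Hits M e) {B : ℕ} {L : List ℕ} {x y : ℕ} (hx : OffSet M x) (hy : InSet M y)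
    (h : search E B L x y = true) : B ≤ M.card := by
  induction L generalizing x y with
  | nil => exact absurd h (by simp [search])
  | cons p L ih =>
    rw [search_cons] at h
    dsimp only at h
    split_ifs at h
    · rw [Bool.and_eq_true] at h
      by_cases hp : decode p ∈ M
      · have hy' : InSet M (upClosure (Nat.lor y (Nat.shiftLeft 1 p))) :=
          (hy.lor fun Q hQ => by rwa [← mem_shiftLeft_one.1 hQ, decode_code] at hp).upClosure hM
        exact le_card_of_closes hx hy' (ih hx hy') h.1
      · have hx' : OffSet M (downClosure (Nat.lor x (Nat.shiftLeft 1 p))) :=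
          (hx.lor fun Q hQ => by rwa [← mem_shiftLeft_one.1 hQ, decode_code] at hp).downClosure hM
        have hy' := (hy.lor (hx'.forced hE)).upClosure hM
        exact le_card_of_closes hx' hy' (ih hx' hy') h.2
    · exact ih hx hy h

/-- Permuting the coordinates turns being hit by `M` into being hit by the permuted set. -/
theorem hits_comp {M : Finset Quad} {e : Quad} (σ : Equiv.Perm (Fin 4))
    (h : Hits M (e ∘ σ)) : Hits (Finset.univ.filter fun Q : Quad => Q ∘ σ ∈ M) e := by
  intro Q hQ he
  obtain ⟨t, ht⟩ := h (fun t => Q t ∘ σ) (fun s t hst i => hQ hst (σ i)) (fun t i => he t (σ i))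
  exact ⟨t, by simpa using ht⟩

theorem le_card_of_check {M : Finset Quad} (hM : IsUpperSet (M : Set Quad)) {E F : List Quad}
    {B : ℕ} {L : List ℕ} (h : check E F B L = true) (σ : Equiv.Perm (Fin 4))
    (hE : ∀ e ∈ E, Hits M (e ∘ σ)) (hF : ∀ d ∈ F, d ∘ σ ∉ M) : B ≤ M.card := by
  set N : Finset Quad := Finset.univ.filter fun Q : Quad => Q ∘ σ ∈ M with hN
  have hNM : N.card ≤ M.card :=
    Finset.card_le_card_of_injOn (fun Q => Q ∘ σ) (fun Q hQ => by simpa [hN] using hQ)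
      (σ.surjective.injective_comp_right.injOn)
  have hNup : IsUpperSet (N : Set Quad) := fun Q R hQR hQ => by
    simp only [hN, Finset.coe_filter, Finset.mem_univ, true_and, Set.mem_ofPred_eq] at hQ ⊢
    exact hM (fun i => hQR (σ i)) hQ
  have hNE : ∀ e ∈ E, Hits N e := fun e he => hits_comp σ (hE e he)
  have hx : OffSet N (downClosure
      (F.foldr (fun d x => Nat.lor x (Nat.shiftLeft 1 (code d))) 0)) := by
    refine OffSet.downClosure hNup ?_
    clear h
    induction F with
    | nil => exact fun Q h => absurd h (not_mem_zero Q)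
    | cons d F ih =>
      rw [List.forall_mem_cons] at hF
      refine (ih hF.2).lor fun Q hQ => ?_
      rw [code_injective (mem_shiftLeft_one.1 hQ)]
      simpa [hN] using hF.1
  simp only [check, force_eq] at h
  have hy := (hx.forced hNE).upClosure hNup
  exact (le_card_of_closes hx hy (le_card_of_search hNup hNE hx hy) h).trans hNM

/-! ### The lower bounds obtained by computation -/

/-- The minimal points of the four full top-stars. -/
def starCorners : List Quad :=
  [![3, 1, 1, 1], ![1, 3, 1, 1], ![1, 1, 3, 1], ![1, 1, 1, 3]]

/-- The instance of `check` that belongs to triples `V` in one set `T I`, with the coordinate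
outside `I` listed first: filling it with the seed value `1` gives hit quads, filling it with
`3` gives quads outside the set by closure. -/
noncomputable def checkTriples (V : List (Fin 3 → Fin 4)) (B : ℕ) (L : List ℕ) : Bool :=
  check (V.map (Matrix.vecCons 1)) (V.map (Matrix.vecCons 3) ++ starCorners) B L

theorem check_zero : check
    [![0, 0, 0, 0]]
    starCorners 27
    [0, 17, 65, 192, 48, 95, 3, 80, 221, 125, 52, 4, 29, 208, 1, 67, 71] = true := by
  decide +kernel

theorem check_triple_110 : checkTriples [![1, 1, 0]] 48
    [65, 194, 200, 101, 224, 216, 41, 8, 90, 74, 102, 0, 214, 37, 210, 33, 4, 25, 9, 82, 36,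
      70, 198, 24, 66, 86, 73, 18, 105, 100] = true := by
  decide +kernel

theorem check_triple_011_110 : checkTriples [![0, 1, 1], ![1, 1, 0]] 49
    [34, 0, 89, 32, 44, 2, 14, 149, 194, 224, 128, 161, 102, 101, 33, 5, 68, 65, 214, 70, 94,
      9, 90, 100, 8, 82, 109, 88, 148, 144, 132, 6, 208] = true := by
  decide +kernel

theorem check_triple_111 : checkTriples [![1, 1, 1]] 55
    [146, 130, 104, 149, 137, 134, 80, 136, 98, 161, 74, 4, 86, 68, 16, 164, 152, 1, 37, 25,
      41, 26, 89, 38, 64, 100, 145, 97, 73, 133, 148, 22, 70, 82, 2, 88, 32, 8, 128, 9, 153,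
      96, 102, 24, 66] = true := by
  decide +kernel

theorem check_triple_230 : checkTriples [![2, 3, 0]] 55
    [36, 9, 104, 8, 41, 198] = true := by
  decide +kernel

theorem check_triple_121_211 : checkTriples [![1, 2, 1], ![2, 1, 1]] 57
    [41, 24, 100, 78, 36, 104, 32, 37, 150, 70, 181, 26, 157, 164, 94] = true := by
  decide +kernel

theorem check_triple_131 : checkTriples [![1, 3, 1]] 63
    [34, 1, 40, 160, 133, 56, 118, 73, 54, 100, 97, 50, 72, 64, 128, 98, 70, 132, 129, 165, 9,
      0] = true := by
  decide +kernel

theorem check_triple_221 : checkTriples [![2, 2, 1]] 63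
    [92, 40, 125, 164, 104, 89, 24, 116, 152, 61, 37, 157, 94, 41, 30, 36, 118, 124] =
      true := by
  decide +kernel

theorem check_triple_330 : checkTriples [![3, 3, 0]] 63
    [34, 10, 40, 48, 8, 104] = true := by
  decide +kernel

/-- The zero values on the supports `{0, 1}` and `{2, 3}`. -/
theorem check_pair_disjoint : check
    [![0, 0, 1, 3], ![0, 0, 3, 1], ![1, 3, 0, 0], ![3, 1, 0, 0]]
    (![0, 0, 3, 3] :: ![3, 3, 0, 0] :: starCorners) 67
    [3, 56, 33, 192, 82, 215, 48, 67, 12, 19, 112, 194, 129, 76, 49, 24, 13, 2, 220, 18, 91] =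
      true := by
  decide +kernel

/-- The zero values on the supports `{0, 1}` and `{0, 2}`. -/
theorem check_pair_adjacent : check
    [![0, 0, 1, 3], ![0, 0, 3, 1], ![0, 1, 0, 3], ![0, 3, 0, 1]]
    (![0, 0, 3, 3] :: ![0, 3, 0, 3] :: starCorners) 67
    [89, 176, 0, 77, 133, 131, 35, 37, 149, 101, 160, 177, 12, 7, 23, 53, 115, 71, 147, 9,
      132, 36, 31, 128, 196, 61, 129, 45, 8, 76, 135, 220, 209, 153] = true := by
  decide +kernel

/-! ### Sets of triples without bad three-matchings -/

/-- A value on three coordinates, indexed by `Fin 3`. -/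
abbrev Triple : Type := Fin 3 → Fin 4

instance {ι : Type} [Fintype ι] (a b : ι → Fin 4) : Decidable (Disj a b) := by
  unfold Disj; infer_instance

instance {ι : Type} [Fintype ι] (a b c : ι → Fin 4) : Decidable (BadThreeMatching a b c) := by
  unfold BadThreeMatching; infer_instance

/-- `T` is a down-set without bad three-matchings. -/
structure NoBad {ι : Type} (T : Finset (ι → Fin 4)) : Prop where
  lower : IsLowerSet (T : Set (ι → Fin 4))
  not_bad : ∀ a ∈ T, ∀ b ∈ T, ∀ c ∈ T, ¬ BadThreeMatching a b c

theorem NoBad.mem_of_le {ι : Type} {T : Finset (ι → Fin 4)} (hT : NoBad T) {y z : ι → Fin 4}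
    (hy : y ∈ T) (h : z ≤ y) : z ∈ T := hT.lower h hy

theorem isLowerSet_image_comp {ι κ : Type} {T : Finset (ι → Fin 4)}
    [DecidableEq (κ → Fin 4)] (hT : IsLowerSet (T : Set (ι → Fin 4))) (τ : κ ≃ ι) :
    IsLowerSet (T.image (· ∘ τ) : Set (κ → Fin 4)) := fun y z hzy hy => by
  simp only [Finset.coe_image, Set.mem_image, Finset.mem_coe] at hy ⊢
  obtain ⟨y, hy, rfl⟩ := hy
  exact ⟨z ∘ τ.symm, hT (fun i => by simpa using hzy (τ.symm i)) hy, by ext i; simp⟩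

theorem BadThreeMatching.comp {ι κ : Type} {a b c : ι → Fin 4} (h : BadThreeMatching a b c)
    (τ : κ ≃ ι) : BadThreeMatching (a ∘ τ) (b ∘ τ) (c ∘ τ) := by
  obtain ⟨hab, hac, hbc, j, u, hu, hj⟩ := h
  exact ⟨fun i => hab _, fun i => hac _, fun i => hbc _, τ.symm j, u, hu, by simpa using hj⟩

/-- Any three distinct points of `l` form a bad three-matching. -/
def IsBadBlock (l : List Triple) : Prop :=
  ∀ a ∈ l, ∀ b ∈ l, ∀ c ∈ l, a ≠ b → a ≠ c → b ≠ c → BadThreeMatching a b c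

instance (l : List Triple) : Decidable (IsBadBlock l) := by unfold IsBadBlock; infer_instance

theorem NoBad.comp {ι κ : Type} [DecidableEq (κ → Fin 4)] {T : Finset (ι → Fin 4)}
    (hT : NoBad T) (τ : κ ≃ ι) : NoBad (T.image (· ∘ τ)) where
  lower := isLowerSet_image_comp hT.lower τ
  not_bad := fun a ha b hb c hc => by
    simp only [Finset.mem_image] at ha hb hc
    obtain ⟨a, ha, rfl⟩ := ha
    obtain ⟨b, hb, rfl⟩ := hb
    obtain ⟨c, hc, rfl⟩ := hc
    intro h
    refine hT.not_bad a ha b hb c hc ?_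
    simpa [Function.comp_def] using h.comp τ.symm

theorem card_image_comp {ι κ : Type} [DecidableEq (κ → Fin 4)] (T : Finset (ι → Fin 4))
    (τ : κ ≃ ι) : (T.image (· ∘ τ)).card = T.card :=
  Finset.card_image_of_injective _ τ.surjective.injective_comp_right

theorem NoBad.card_filter_mem_le_two {T : Finset Triple} (hT : NoBad T) {l : List Triple}
    (hl : IsBadBlock l) : (T.filter (· ∈ l)).card ≤ 2 := by
  by_contra! h
  obtain ⟨a, ha, b, hb, c, hc, hab, hac, hbc⟩ := Finset.two_lt_card.1 h
  simp only [Finset.mem_filter] at ha hb hc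
  exact hT.not_bad a ha.1 b hb.1 c hc.1 (hl a ha.2 b hb.2 c hc.2 hab hac hbc)

theorem NoBad.card_le_two_mul_add {T : Finset Triple} (hT : NoBad T) {L : List (List Triple)}
    (hL : ∀ l ∈ L, IsBadBlock l) :
    T.card ≤ 2 * L.length + (T.filter fun y => ∀ l ∈ L, y ∉ l).card := by
  induction L with
  | nil => simp
  | cons l L ih =>
    rw [List.forall_mem_cons] at hL
    have h1 := ih hL.2
    have h2 := hT.card_filter_mem_le_two hL.1
    have h3 : (T.filter fun y => ∀ k ∈ L, y ∉ k).card ≤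
        (T.filter (· ∈ l)).card + (T.filter fun y => ∀ k ∈ l :: L, y ∉ k).card := by
      refine (Finset.card_le_card fun y hy => ?_).trans (Finset.card_union_le _ _)
      simp only [Finset.mem_union, Finset.mem_filter, List.forall_mem_cons] at hy ⊢
      tauto
    rw [List.length_cons]
    omega

/-- The blocks in `L` contribute at most two points each; all other points of `T` lie in none of the
blocks and above none of the excluded points in `V`. -/
theorem NoBad.card_le {T : Finset Triple} (hT : NoBad T) {V : Finset Triple}
    (hV : ∀ v ∈ V, v ∉ T) (L : List (List Triple)) (n : ℕ)
    (h : (∀ l ∈ L, IsBadBlock l) ∧ 2 * L.length +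
      (Finset.univ.filter fun y : Triple => (∀ v ∈ V, ∃ i, y i < v i) ∧ ∀ l ∈ L, y ∉ l).card ≤ n) :
    T.card ≤ n := by
  refine ((hT.card_le_two_mul_add h.1).trans (Nat.add_le_add_left ?_ _)).trans h.2
  refine Finset.card_le_card fun y hy => ?_
  rw [Finset.mem_filter] at hy ⊢
  refine ⟨Finset.mem_univ _, fun v hv => ?_, hy.2⟩
  by_contra! hvy
  exact hV v hv (hT.mem_of_le hy.1 hvy)

/-- The points obtained from `v` by permuting its coordinates. -/
def orbit (v : Triple) : Finset Triple :=
  Finset.univ.image fun τ : Equiv.Perm (Fin 3) => v ∘ τ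

/-- No permutation of `v` belongs to `T`. -/
def Avoids (T : Finset Triple) (v : Triple) : Prop := ∀ y ∈ orbit v, y ∉ T

theorem avoids_iff {T : Finset Triple} {v : Triple} :
    Avoids T v ↔ ∀ τ : Equiv.Perm (Fin 3), v ∘ τ ∉ T := by
  simp [Avoids, orbit]

theorem mem_image_comp_symm {T : Finset Triple} {v : Triple} {τ : Equiv.Perm (Fin 3)} :
    v ∈ T.image (· ∘ τ.symm) ↔ v ∘ τ ∈ T := by
  rw [Finset.mem_image]
  constructor
  · rintro ⟨y, hy, rfl⟩
    simpa [Function.comp_def] using hy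
  · exact fun h => ⟨_, h, by simp [Function.comp_def]⟩

theorem Avoids.comp {T : Finset Triple} {v : Triple} (h : Avoids T v) (τ : Equiv.Perm (Fin 3)) :
    Avoids (T.image (· ∘ τ.symm)) v := by
  rw [avoids_iff] at h ⊢
  intro ρ hρ
  exact h (τ.trans ρ) (mem_image_comp_symm (v := v ∘ ρ).1 hρ)

theorem forall_mem_union_of {T V W : Finset Triple} (hV : ∀ v ∈ V, v ∉ T) (hW : ∀ v ∈ W, v ∉ T) :
    ∀ v ∈ V ∪ W, v ∉ T := fun v hv => (Finset.mem_union.1 hv).elim (hV v) (hW v)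

theorem NoBad.card_le_ten {T : Finset Triple} (hT : NoBad T) (h : Avoids T ![1, 1, 0]) :
    T.card ≤ 10 :=
  hT.card_le h [] 10 (by decide +kernel)

/-- At most one of `(0, 1, 1)`, `(1, 0, 1)`, `(1, 1, 0)` belongs to `T`. -/
theorem NoBad.card_le_nineteen {T : Finset Triple} (hT : NoBad T)
    (h : ∀ τ : Equiv.Perm (Fin 3), ![0, 1, 1] ∘ τ ∉ T ∨ ![1, 1, 0] ∘ τ ∉ T) : T.card ≤ 19 := by
  have key : ∀ v w : Triple, v ∉ T → w ∉ T → ∀ x ∈ ({v, w} : Finset Triple), x ∉ T := by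
    intro v w hv hw x hx
    simp only [Finset.mem_insert, Finset.mem_singleton] at hx
    rcases hx with rfl | rfl <;> assumption
  have h1 : ![0, 1, 1] ∉ T ∨ ![1, 1, 0] ∉ T := h 1
  have h2 : ![0, 1, 1] ∉ T ∨ ![1, 0, 1] ∉ T := by
    have := h (Equiv.swap 1 2)
    rwa [show (![0, 1, 1] : Triple) ∘ ⇑(Equiv.swap 1 2) = ![0, 1, 1] by decide,
      show (![1, 1, 0] : Triple) ∘ ⇑(Equiv.swap 1 2) = ![1, 0, 1] by decide] at this
  have h3 : ![1, 0, 1] ∉ T ∨ ![1, 1, 0] ∉ T := by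
    have := h (Equiv.swap 0 1)
    rwa [show (![0, 1, 1] : Triple) ∘ ⇑(Equiv.swap 0 1) = ![1, 0, 1] by decide,
      show (![1, 1, 0] : Triple) ∘ ⇑(Equiv.swap 0 1) = ![1, 1, 0] by decide] at this
  by_cases ha : ![0, 1, 1] ∈ T
  · exact hT.card_le (key _ _ (h1.resolve_left (not_not.2 ha)) (h2.resolve_left (not_not.2 ha)))
      [] 19 (by decide +kernel)
  · rcases h3 with hb | hb
    · exact hT.card_le (key _ _ ha hb) [] 19 (by decide +kernel)
    · exact hT.card_le (key _ _ ha hb) [] 19 (by decide +kernel)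

theorem NoBad.card_le_twentyFive {T : Finset Triple} (hT : NoBad T) (h₁ : Avoids T ![1, 1, 1])
    (h₂ : Avoids T ![2, 3, 0]) : T.card ≤ 25 :=
  hT.card_le (forall_mem_union_of h₁ h₂)
    [[![2, 1, 0], ![3, 0, 1], ![0, 2, 2]],
      [![2, 2, 0], ![0, 1, 2], ![1, 0, 3]],
      [![3, 1, 0], ![0, 2, 1], ![2, 0, 2]]] 25 (by decide +kernel)

/-- At most one of `(1, 1, 2)`, `(1, 2, 1)`, `(2, 1, 1)` belongs to `T`.  After a permutation of the
coordinates, the last two of them are missing. -/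
theorem NoBad.card_le_twentyEight {T : Finset Triple} (hT : NoBad T)
    (h₁ : Avoids T ![1, 3, 1]) (h₂ : Avoids T ![2, 2, 1]) (h₃ : Avoids T ![3, 3, 0])
    (h : ∀ τ : Equiv.Perm (Fin 3), ![1, 2, 1] ∘ τ ∉ T ∨ ![2, 1, 1] ∘ τ ∉ T) : T.card ≤ 28 := by
  -- At least two of the points `(1, 2, 1)`, `(2, 1, 1)`, `(1, 1, 2)` are missing from `T`.
  have key : ∃ τ : Equiv.Perm (Fin 3), ![1, 2, 1] ∘ τ ∉ T ∧ ![2, 1, 1] ∘ τ ∉ T := by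
    have e : ∀ v : Triple, v ∘ ⇑(1 : Equiv.Perm (Fin 3)) = v := fun _ => rfl
    have h1 := h 1
    have h2 := h (Equiv.swap 0 2)
    have h3 := h (Equiv.swap 1 2)
    rw [e, e] at h1
    rw [show (![1, 2, 1] : Triple) ∘ ⇑(Equiv.swap 0 2) = ![1, 2, 1] by decide,
      show (![2, 1, 1] : Triple) ∘ ⇑(Equiv.swap 0 2) = ![1, 1, 2] by decide] at h2
    rw [show (![1, 2, 1] : Triple) ∘ ⇑(Equiv.swap 1 2) = ![1, 1, 2] by decide,
      show (![2, 1, 1] : Triple) ∘ ⇑(Equiv.swap 1 2) = ![2, 1, 1] by decide] at h3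
    by_cases ha : ![1, 2, 1] ∈ T
    · refine ⟨Equiv.swap 1 2, ?_⟩
      rw [show (![1, 2, 1] : Triple) ∘ ⇑(Equiv.swap 1 2) = ![1, 1, 2] by decide,
        show (![2, 1, 1] : Triple) ∘ ⇑(Equiv.swap 1 2) = ![2, 1, 1] by decide]
      exact ⟨h2.resolve_left (not_not.2 ha), h1.resolve_left (not_not.2 ha)⟩
    · rcases h3 with hb | hb
      · refine ⟨Equiv.swap 0 2, ?_⟩
        rw [show (![1, 2, 1] : Triple) ∘ ⇑(Equiv.swap 0 2) = ![1, 2, 1] by decide,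
          show (![2, 1, 1] : Triple) ∘ ⇑(Equiv.swap 0 2) = ![1, 1, 2] by decide]
        exact ⟨ha, hb⟩
      · exact ⟨1, ha, hb⟩
  obtain ⟨τ, ha, hb⟩ := key
  rw [← mem_image_comp_symm] at ha hb
  rw [← card_image_comp T τ.symm]
  have hW : ∀ v ∈ ({![1, 2, 1], ![2, 1, 1]} : Finset Triple), v ∉ T.image (· ∘ τ.symm) := by
    intro v hv
    simp only [Finset.mem_insert, Finset.mem_singleton] at hv
    rcases hv with rfl | rfl <;> assumption
  exact (hT.comp τ.symm).card_le (forall_mem_union_of (forall_mem_union_of (forall_mem_union_of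
      (h₁.comp τ) (h₂.comp τ)) (h₃.comp τ)) hW)
    [[![2, 0, 0], ![1, 1, 2], ![0, 2, 3]],
      [![2, 2, 0], ![0, 1, 1], ![3, 0, 2]],
      [![2, 1, 0], ![3, 0, 1], ![0, 2, 2]],
      [![1, 3, 0], ![0, 2, 1], ![2, 0, 2]],
      [![2, 3, 0], ![1, 0, 2], ![0, 1, 3]],
      [![3, 1, 0], ![2, 0, 1], ![0, 3, 2]],
      [![1, 2, 0], ![0, 3, 1], ![2, 0, 3]],
      [![3, 2, 0], ![0, 1, 2], ![1, 0, 3]]] 28 (by decide +kernel)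

theorem NoBad.card_le_twentyNine {T : Finset Triple} (hT : NoBad T)
    (h₁ : Avoids T ![1, 3, 1]) (h₂ : Avoids T ![2, 2, 1]) (h₃ : Avoids T ![3, 3, 0]) :
    T.card ≤ 29 :=
  hT.card_le (forall_mem_union_of (forall_mem_union_of h₁ h₂) h₃)
    [[![2, 0, 0], ![1, 2, 1], ![0, 3, 2]],
      [![3, 2, 0], ![2, 1, 1], ![0, 0, 2]],
      [![0, 2, 0], ![1, 1, 2], ![2, 0, 3]],
      [![1, 2, 0], ![0, 3, 1], ![2, 0, 2]],
      [![3, 1, 0], ![2, 0, 1], ![0, 2, 2]],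
      [![2, 2, 0], ![0, 1, 2], ![1, 0, 3]],
      [![2, 1, 0], ![3, 0, 1], ![0, 2, 3]],
      [![1, 3, 0], ![0, 2, 1], ![3, 0, 2]],
      [![2, 3, 0], ![1, 0, 2], ![0, 1, 3]]] 29 (by decide +kernel)

/-- If `(2, 2, 2)` belongs to `T`, then no value `3` occurs, because a point with an entry `3` lies
above one that is bad together with `(1, 1, 1)` and `(2, 2, 2)`.  Otherwise the blocks are the
classes `{y, y ⊕ 1, y ⊕ 2, y ⊕ 3}`, with the same bitwise sum in all coordinates, that contain no
point of `{2, 3}³`: the point missing from three members of a class has an entry `0` or `1`. -/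
theorem NoBad.card_le_thirtyTwo {T : Finset Triple} (hT : NoBad T) : T.card ≤ 32 := by
  by_cases h : ![2, 2, 2] ∈ T
  · have h1 : ![1, 1, 1] ∈ T := hT.mem_of_le h fun i => by revert i; decide
    have h3 : Avoids T ![3, 0, 0] := fun v hv hvT => by
      refine hT.not_bad v hvT _ h1 _ h ?_
      clear hvT
      revert v
      decide +kernel
    exact (hT.card_le h3 [] 27 (by decide +kernel)).trans (by norm_num)
  · exact hT.card_le (V := {![2, 2, 2]}) (by simpa using h)
      [[![0, 0, 2], ![1, 1, 3], ![2, 2, 0], ![3, 3, 1]],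
      [![0, 0, 3], ![1, 1, 2], ![2, 2, 1], ![3, 3, 0]],
      [![0, 1, 2], ![1, 0, 3], ![2, 3, 0], ![3, 2, 1]],
      [![0, 1, 3], ![1, 0, 2], ![2, 3, 1], ![3, 2, 0]],
      [![0, 2, 0], ![1, 3, 1], ![2, 0, 2], ![3, 1, 3]],
      [![0, 2, 1], ![1, 3, 0], ![2, 0, 3], ![3, 1, 2]],
      [![0, 2, 2], ![1, 3, 3], ![2, 0, 0], ![3, 1, 1]],
      [![0, 2, 3], ![1, 3, 2], ![2, 0, 1], ![3, 1, 0]],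
      [![0, 3, 0], ![1, 2, 1], ![2, 1, 2], ![3, 0, 3]],
      [![0, 3, 1], ![1, 2, 0], ![2, 1, 3], ![3, 0, 2]],
      [![0, 3, 2], ![1, 2, 3], ![2, 1, 0], ![3, 0, 1]],
      [![0, 3, 3], ![1, 2, 2], ![2, 1, 1], ![3, 0, 0]]] 32 (by decide +kernel)

/-! ### Pairs, seeds and the bound for one set of triples -/

instance {ι : Type} [Fintype ι] (a b : ι → Fin 4) : Decidable (PairObstruction a b) := by
  unfold PairObstruction; infer_instance

/-- If `(1, 1) ∈ P`, then `P ⊆ {0, 1}²`; otherwise the difference of the two coordinates modulo `4`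
is injective on `P`. -/
theorem card_le_four {P : Finset (Fin 2 → Fin 4)} (hP : IsLowerSet (P : Set (Fin 2 → Fin 4)))
    (h : ∀ a ∈ P, ∀ b ∈ P, ¬ PairObstruction a b) : P.card ≤ 4 := by
  by_cases h1 : ![1, 1] ∈ P
  · have hsub : P ⊆ Finset.univ.filter fun y : Fin 2 → Fin 4 => y 0 ≤ 1 ∧ y 1 ≤ 1 := by
      intro y hy
      have key : ∀ y : Fin 2 → Fin 4, (y 0 ≤ 1 ∧ y 1 ≤ 1) ∨ (∀ i, (![2, 0] : Fin 2 → Fin 4) i ≤ y i)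
          ∨ ∀ i, (![0, 2] : Fin 2 → Fin 4) i ≤ y i := by decide +kernel
      rcases key y with hy' | hy' | hy'
      · exact Finset.mem_filter.2 ⟨Finset.mem_univ _, hy'⟩
      · exact absurd (by decide) (h _ h1 _ (hP hy' hy))
      · exact absurd (by decide) (h _ h1 _ (hP hy' hy))
    exact (Finset.card_le_card hsub).trans (by decide +kernel)
  · have key : ∀ y z : Fin 2 → Fin 4, y 1 - y 0 = z 1 - z 0 →
        y = z ∨ y = ![1, 1] ∨ z = ![1, 1] ∨ PairObstruction y z := by decide +kernel
    refine (Finset.card_le_card_of_injOn (t := Finset.univ) (fun y => y 1 - y 0)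
      (fun _ _ => Finset.mem_coe.2 (Finset.mem_univ _)) fun y hy z hz hyz => ?_).trans
      (Finset.card_univ (α := Fin 4)).le
    rcases key y z hyz with h2 | rfl | rfl | h2
    exacts [h2, absurd hy h1, absurd hz h1, absurd h2 (h y hy z hz)]

/-- An entry `0` or `1` of `e` outside `S` is a seed, and quads disjoint from `e` are disjoint from
`H` and from that seed. -/
theorem SeedHitting.hits {M : Finset Quad} {S : Finset (Fin 4)} {H : Value S}
    (h : SeedHitting M H) {e : Quad} (he : restrict S e = H) {j : Fin 4} (hj : j ∉ S)
    (hu : e j ∈ ({0, 1} : Finset (Fin 4))) : Hits M e := by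
  subst he
  exact fun Q hQ hQe => h j (e j) Q
    ⟨hu, fun i hi => absurd (hi ▸ i.2) hj, hQ, fun t i => hQe t i, fun t => hQe t j⟩

theorem hits_zero {M : Finset Quad} (h : ¬ HasThreeMatching (upperCube \ M)) :
    Hits M ![0, 0, 0, 0] := by
  intro Q hQ h0
  by_contra! hQM
  refine h ⟨Q, fun t => ?_, hQ⟩
  simp only [Finset.mem_sdiff, upperCube, Finset.mem_filter, Finset.mem_univ, true_and]
  refine ⟨fun i => ?_, hQM t⟩
  have h1 : (![0, 0, 0, 0] : Quad) i = 0 := by revert i; decide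
  exact h1 ▸ h0 t i

theorem comp_notMem_of_mem_starCorners {M : Finset Quad} (hM : IsUpperSet (M : Set Quad))
    (h : ∀ i : Fin 4, ¬ topStar i ⊆ M ∩ upperCube) (σ : Equiv.Perm (Fin 4)) :
    ∀ d ∈ starCorners, d ∘ σ ∉ M := by
  intro d hd hdM
  have key : ∀ d ∈ starCorners, ∃ k, ∀ l, l ≠ k → d l ≤ 1 := by decide +kernel
  obtain ⟨k, h1⟩ := key d hd
  refine h (σ.symm k) fun x hx => ?_
  simp only [topStar, upperCube, Finset.mem_filter, Finset.mem_univ, true_and,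
    Finset.mem_inter] at hx ⊢
  refine ⟨hM (fun i => ?_) hdM, hx.1⟩
  by_cases hi : σ i = k
  · obtain rfl : i = σ.symm k := by simp [← hi]
    rw [hx.2]
    exact Fin.le_last _
  · refine (h1 _ hi).trans ?_
    have := hx.1 i
    omega

/-- `T`, read as a set of values on the coordinates other than `j`, has the two properties of values
with closure and seed hitting that are used: extending by the seed value `1` in coordinate `j`
gives hit quads, and extending by `3` gives quads outside `M`. -/
structure Seeded (M : Finset Quad) (j : Fin 4) (T : Finset Triple) : Prop where
  hits : ∀ y ∈ T, Hits M (j.insertNth 1 y)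
  notMem : ∀ y ∈ T, (j.insertNth 3 y : Quad) ∉ M

/-- Permuting the entries of a triple and moving the extra coordinate amounts to one permutation of
the four coordinates. -/
theorem exists_insertNth_eq_cons_comp (j : Fin 4) (τ : Equiv.Perm (Fin 3)) :
    ∃ σ : Equiv.Perm (Fin 4), ∀ (u : Fin 4) (v : Triple),
      (j.insertNth u (v ∘ τ) : Quad) = (Matrix.vecCons u v : Quad) ∘ σ := by
  refine ⟨(finSuccEquiv' j).trans ((Equiv.optionCongr τ).trans (finSuccEquiv' 0).symm),
    fun u v => ?_⟩
  ext i
  rcases Fin.eq_self_or_eq_succAbove j i with rfl | ⟨k, rfl⟩ <;> simp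

/-- The lower bound for `|M|` forced by the presence of the triples `V`, up to a permutation of
their coordinates. -/
theorem Seeded.le_card {M : Finset Quad} {j : Fin 4} {T : Finset Triple} (h : Seeded M j T)
    (hM : IsUpperSet (M : Set Quad))
    (hstar : ∀ σ : Equiv.Perm (Fin 4), ∀ d ∈ starCorners, d ∘ σ ∉ M)
    {V : List Triple} {B : ℕ} {L : List ℕ} (hc : checkTriples V B L = true)
    (τ : Equiv.Perm (Fin 3)) (hV : ∀ v ∈ V, v ∘ τ ∈ T) : B ≤ M.card := by
  obtain ⟨σ, hσ⟩ := exists_insertNth_eq_cons_comp j τ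
  refine le_card_of_check hM hc σ (fun e he => ?_) fun d hd => ?_
  · obtain ⟨v, hv, rfl⟩ := List.mem_map.1 he
    exact hσ 1 v ▸ h.hits _ (hV v hv)
  · rcases List.mem_append.1 hd with hd | hd
    · obtain ⟨v, hv, rfl⟩ := List.mem_map.1 hd
      exact hσ 3 v ▸ h.notMem _ (hV v hv)
    · exact hstar σ d hd

/-- The numbers `48`, `49`, `55`, `57`, `63` are the lower bounds for `|M|` forced by the respective
triples or pairs of triples; below each of them these are not contained in `T`. -/
theorem Seeded.card_le {M : Finset Quad} {j : Fin 4} {T : Finset Triple} (h : Seeded M j T)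
    (hT : NoBad T) (hM : IsUpperSet (M : Set Quad))
    (hstar : ∀ σ : Equiv.Perm (Fin 4), ∀ d ∈ starCorners, d ∘ σ ∉ M) (h27 : 27 ≤ M.card) :
    1200 * T.card + 576 ≤ 625 * M.card := by
  have avoids : ∀ {v B L}, checkTriples [v] B L = true → M.card < B → Avoids T v := by
    intro v B L hc hB
    refine avoids_iff.2 fun τ hv => ?_
    exact absurd (h.le_card hM hstar hc τ (by simpa using hv)) (by omega)
  have avoids₂ : ∀ {v w B L}, checkTriples [v, w] B L = true → M.card < B →
      ∀ τ : Equiv.Perm (Fin 3), v ∘ τ ∉ T ∨ w ∘ τ ∉ T := by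
    intro v w B L hc hB τ
    by_contra! hvw
    exact absurd (h.le_card hM hstar hc τ (by simpa using hvw)) (by omega)
  have h63 := hT.card_le_thirtyTwo
  rcases lt_or_ge M.card 63 with hlt | hge
  · have h₁ := avoids check_triple_131 hlt
    have h₂ := avoids check_triple_221 hlt
    have h₃ := avoids check_triple_330 hlt
    rcases lt_or_ge M.card 57 with hlt | hge
    · rcases lt_or_ge M.card 55 with hlt | hge
      · rcases lt_or_ge M.card 49 with hlt | hge
        · rcases lt_or_ge M.card 48 with hlt | hge
          · have := hT.card_le_ten (avoids check_triple_110 hlt)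
            omega
          · have := hT.card_le_nineteen (avoids₂ check_triple_011_110 hlt)
            omega
        · have := hT.card_le_twentyFive (avoids check_triple_111 hlt)
            (avoids check_triple_230 hlt)
          omega
      · have := hT.card_le_twentyEight h₁ h₂ h₃ (avoids₂ check_triple_121_211 hlt)
        omega
    · have := hT.card_le_twentyNine h₁ h₂ h₃
      omega
  · omega

/-! ### Supports -/

/-- Two distinct two-element supports can be moved to `{0, 1}` and one of `{2, 3}`, `{0, 2}`. -/
theorem exists_perm_of_ne : ∀ J K : Finset (Fin 4), J.card = 2 → K.card = 2 → J ≠ K →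
    ∃ σ : Equiv.Perm (Fin 4), (∀ i ∈ J, σ i ∈ ({0, 1} : Finset (Fin 4))) ∧
      ((∀ i ∈ K, σ i ∈ ({2, 3} : Finset (Fin 4))) ∨
        ∀ i ∈ K, σ i ∈ ({0, 2} : Finset (Fin 4))) := by
  decide +kernel

theorem total_card {k : ℕ} (F : (S : Support k) → Finset (Value S.1)) :
    (total F).card = ∑ S, (F S).card := by
  rw [total, Finset.card_sigma]

theorem card_pair_le_four {J : Support 2} {P : Finset (Value J.1)}
    (h : IsLowerSet (P : Set (Value J.1)) ∧ ∀ a ∈ P, ∀ b ∈ P, ¬ PairObstruction a b) :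
    P.card ≤ 4 := by
  classical
  let e : Fin 2 ≃ J.1 := (J.1.equivFinOfCardEq J.2).symm
  rw [← card_image_comp P e]
  refine card_le_four (isLowerSet_image_comp h.1 e) ?_
  intro x hx y hy hxy
  obtain ⟨a, ha, rfl⟩ := Finset.mem_image.1 hx
  obtain ⟨b, hb, rfl⟩ := Finset.mem_image.1 hy
  obtain ⟨h1, j, hj⟩ := hxy
  exact h.2 a ha b hb ⟨fun i => by simpa using h1 (e.symm i), e j, hj⟩

/-- The zero value lies in both down-sets.  Extending it by `1` in one of the other two coordinates
and by anything in the other gives hit quads, and all its extensions lie outside `M`. -/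
theorem le_card_of_two_pair_supports {M : Finset Quad} (hM : IsUpperSet (M : Set Quad))
    (hstar : ∀ σ : Equiv.Perm (Fin 4), ∀ d ∈ starCorners, d ∘ σ ∉ M)
    {P : (J : Support 2) → Finset (Value J.1)}
    (hlow : ∀ J, IsLowerSet (P J : Set (Value J.1)))
    (hP : ∀ J, ∀ H ∈ P J, Closed M H ∧ SeedHitting M H) {J K : Support 2} (hJK : J ≠ K)
    (hJ : (P J).Nonempty) (hK : (P K).Nonempty) : 67 ≤ M.card := by
  have zero : ∀ {S : Support 2}, (P S).Nonempty → (fun _ => 0 : Value S.1) ∈ P S := by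
    rintro S ⟨H, hH⟩
    exact hlow S (fun i => Fin.zero_le _) hH
  have restr : ∀ {S : Support 2} {A : Finset (Fin 4)} {σ : Equiv.Perm (Fin 4)} {e : Quad},
      (∀ i ∈ S.1, σ i ∈ A) → (∀ k ∈ A, e k = 0) → restrict S.1 (e ∘ σ) = fun _ => 0 :=
    fun hA he => funext fun i => he _ (hA i i.2)
  have hits : ∀ {S : Support 2} {A : Finset (Fin 4)} {σ : Equiv.Perm (Fin 4)} {e : Quad},
      (P S).Nonempty → (∀ i ∈ S.1, σ i ∈ A) → (∀ k ∈ A, e k = 0) → ∀ k ∉ A, e k = 1 →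
      Hits M (e ∘ σ) := by
    intro S A σ e hS hA he k hk hek
    refine (hP S _ (zero hS)).2.hits (j := σ.symm k) (restr hA he) (fun hkS => hk ?_) ?_
    · simpa using hA _ hkS
    · simp [hek]
  have off : ∀ {S : Support 2} {A : Finset (Fin 4)} {σ : Equiv.Perm (Fin 4)} {e : Quad},
      (P S).Nonempty → (∀ i ∈ S.1, σ i ∈ A) → (∀ k ∈ A, e k = 0) → e ∘ σ ∉ M :=
    fun hS hA he => (hP _ _ (zero hS)).1 _ (restr hA he)
  obtain ⟨σ, hσ, hσ' | hσ'⟩ := exists_perm_of_ne J.1 K.1 J.2 K.2 (fun h => hJK (Subtype.ext h))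
  · refine le_card_of_check hM check_pair_disjoint σ (fun e he => ?_) (fun d hd => ?_)
    · simp only [List.mem_cons, List.not_mem_nil, or_false] at he
      rcases he with rfl | rfl | rfl | rfl
      exacts [hits hJ hσ (by decide) 2 (by decide) rfl, hits hJ hσ (by decide) 3 (by decide) rfl,
        hits hK hσ' (by decide) 0 (by decide) rfl, hits hK hσ' (by decide) 1 (by decide) rfl]
    · rcases List.mem_cons.1 hd with rfl | hd
      · exact off hJ hσ (by decide)
      rcases List.mem_cons.1 hd with rfl | hd
      · exact off hK hσ' (by decide)
      · exact hstar σ d hd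
  · refine le_card_of_check hM check_pair_adjacent σ (fun e he => ?_) (fun d hd => ?_)
    · simp only [List.mem_cons, List.not_mem_nil, or_false] at he
      rcases he with rfl | rfl | rfl | rfl
      exacts [hits hJ hσ (by decide) 2 (by decide) rfl, hits hJ hσ (by decide) 3 (by decide) rfl,
        hits hK hσ' (by decide) 1 (by decide) rfl, hits hK hσ' (by decide) 3 (by decide) rfl]
    · rcases List.mem_cons.1 hd with rfl | hd
      · exact off hJ hσ (by decide)
      rcases List.mem_cons.1 hd with rfl | hd
      · exact off hK hσ' (by decide)
      · exact hstar σ d hd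

/-- Identifies a support of size three, the complement of a coordinate `j`, with `Fin 3`. -/
theorem exists_seeded_noBad {M : Finset Quad} {I : Support 3} {T : Finset (Value I.1)}
    (hT : NoBad T) (h : ∀ H ∈ T, Closed M H ∧ SeedHitting M H) :
    ∃ (j : Fin 4) (T' : Finset Triple), T'.card = T.card ∧ NoBad T' ∧ Seeded M j T' := by
  classical
  obtain ⟨j, hj⟩ : ∃ j, I.1ᶜ = {j} := Finset.card_eq_one.1 (by
    rw [Finset.card_compl, I.2, Fintype.card_fin])
  have hmem : ∀ i, i ∈ I.1 ↔ i ≠ j := fun i => by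
    rw [← not_iff_not, ← Finset.mem_compl, hj, Finset.mem_singleton, not_not]
  let e : Fin 3 ≃ I.1 :=
    (finSuccAboveEquiv j).trans (Equiv.subtypeEquivRight fun i => (hmem i).symm)
  have he : ∀ k, ((e k : I.1) : Fin 4) = j.succAbove k := fun k => rfl
  have hr : ∀ (u : Fin 4) (H : Value I.1), restrict I.1 (j.insertNth u (H ∘ e)) = H := by
    intro u H
    funext i
    obtain ⟨k, rfl⟩ := e.surjective i
    simp [restrict, he]
  refine ⟨j, T.image (· ∘ e), card_image_comp T e, hT.comp e, fun y hy => ?_, fun y hy => ?_⟩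
  · obtain ⟨H, hH, rfl⟩ := Finset.mem_image.1 hy
    exact (h H hH).2.hits (hr 1 H) (j := j) (by simp [hmem]) (by simp)
  · obtain ⟨H, hH, rfl⟩ := Finset.mem_image.1 hy
    exact (h H hH).1 _ (hr 3 H)

end NoTopStar

theorem mainTheorem6
    (M : Finset NoTopStar.Quad)
    (P : (J : NoTopStar.Support 2) → Finset (NoTopStar.Value J.1))
    (T : (I : NoTopStar.Support 3) → Finset (NoTopStar.Value I.1))
    (hN1 : IsUpperSet (M : Set NoTopStar.Quad))
    (hN2 : ¬ NoTopStar.HasThreeMatching (NoTopStar.upperCube \ M))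
    (hN3 : ∀ i : Fin 4, ¬ NoTopStar.topStar i ⊆ M ∩ NoTopStar.upperCube)
    (hN4_pair : ∀ J : NoTopStar.Support 2, IsLowerSet (P J : Set (NoTopStar.Value J.1)) ∧
      ∀ a ∈ P J, ∀ b ∈ P J, ¬ NoTopStar.PairObstruction a b)
    (hN4_triple : ∀ I : NoTopStar.Support 3, IsLowerSet (T I : Set (NoTopStar.Value I.1)) ∧
      ∀ a ∈ T I, ∀ b ∈ T I, ∀ c ∈ T I, ¬ NoTopStar.BadThreeMatching a b c)
    (hN5_pair : ∀ J : NoTopStar.Support 2, ∀ H ∈ P J,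
      NoTopStar.Closed M H ∧ NoTopStar.SeedHitting M H)
    (hN5_triple : ∀ I : NoTopStar.Support 3, ∀ H ∈ T I,
      NoTopStar.Closed M H ∧ NoTopStar.SeedHitting M H) :
    300 * (NoTopStar.total T).card + 144 * (NoTopStar.total P).card ≤ 625 * M.card := by
  have hstar := NoTopStar.comp_notMem_of_mem_starCorners hN1 hN3
  have h27 : 27 ≤ M.card := by
    refine NoTopStar.le_card_of_check hN1 NoTopStar.check_zero 1 (fun e he => ?_) (hstar 1)
    rw [List.mem_singleton.1 he]
    exact NoTopStar.hits_zero hN2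
  have hT : ∀ I, (T I).card ≤ 32 ∧ 1200 * (T I).card + 576 ≤ 625 * M.card := by
    intro I
    obtain ⟨j, T', hc, hT', hs⟩ := NoTopStar.exists_seeded_noBad
      ⟨(hN4_triple I).1, (hN4_triple I).2⟩ (hN5_triple I)
    exact hc ▸ ⟨hT'.card_le_thirtyTwo, hs.card_le hT' hN1 hstar h27⟩
  have hP : ∀ J, (P J).card ≤ 4 := fun J => NoTopStar.card_pair_le_four (hN4_pair J)
  rw [NoTopStar.total_card, NoTopStar.total_card]
  have c3 : Fintype.card (NoTopStar.Support 3) = 4 := by decide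
  have c2 : Fintype.card (NoTopStar.Support 2) = 6 := by decide
  rcases lt_or_ge M.card 67 with hlt | hge
  · have hP' : ∑ J, (P J).card ≤ 4 := by
      by_cases hne : ∃ J, (P J).Nonempty
      · obtain ⟨J, hJ⟩ := hne
        rw [Finset.sum_eq_single J (fun K _ hKJ => ?_) (fun h => absurd (Finset.mem_univ _) h)]
        · exact hP J
        · by_contra hK
          have := NoTopStar.le_card_of_two_pair_supports hN1 hstar (fun J => (hN4_pair J).1)
            hN5_pair hKJ (Finset.card_ne_zero.1 hK) hJ
          omega
      · push Not at hne
        simp [hne]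
    have hT' : ∑ I, (1200 * (T I).card + 576) ≤ ∑ _I : NoTopStar.Support 3, 625 * M.card :=
      Finset.sum_le_sum fun I _ => (hT I).2
    rw [Finset.sum_add_distrib, ← Finset.mul_sum, Finset.sum_const, Finset.sum_const,
      Finset.card_univ, c3] at hT'
    simp only [smul_eq_mul] at hT'
    omega
  · have hT' : ∑ I, (T I).card ≤ Fintype.card (NoTopStar.Support 3) * 32 := by
      simpa using Finset.sum_le_card_nsmul Finset.univ _ 32 fun I _ => (hT I).1
    have hP' : ∑ J, (P J).card ≤ Fintype.card (NoTopStar.Support 2) * 4 := by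
      simpa using Finset.sum_le_card_nsmul Finset.univ _ 4 fun J _ => hP J
    rw [c3] at hT'
    rw [c2] at hP'
    omega
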